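/- Let $\mathcal H^A,\mathcal H^B$ be finite-dimensional complex Hilbert spaces and put $d=\min\{\dim\mathcal H^A,\dim\mathcal H^B\}$. Let $\Delta_d^{\downarrow}$ be the set of vectors $u\in\mathbb R^d$ with $u_1\ge\dots\ge u_d\ge 0$ and $\sum_i u_i=1$, partially ordered by majorization: $u\preceq v$ if and only if $\sum_{i=1}^k u_i\le\sum_{i=1}^k v_i$ for all $k\in\{1,\dots,d-1\}$. For a unit vector $|\psi\rangle\in\mathcal H^A\otimes\mathcal H^B$, let $\mu^{\downarrow}(\psi)\in\Delta_d^{\downarrow}$ be its sorted Schmidt vector, that is, $|\psi\rangle=\sum_{i=1}^d\sqrt{\mu_i^{\downarrow}(\psi)}\,|a_i\rangle|b_i\rangle$ for some orthonormal families $(a_i)$ in $\mathcal H^A$ and $(b_i)$ in $\mathcal H^B$, and let $\mathcal R(\psi)=\operatorname{rank}\operatorname{tr}_A|\psi\rangle\langle\psi|$ be its Schmidt rank. For a bipartite state $\rho$ (a positive semidefinite operator of trace one on $\mathcal H^A\otimes\mathcal H^B$), let $\mathcal D(\rho)$ be the set of its pure-state decompositions, i.e. of all finite families $\{q_i,|\psi_i\rangle\}_{i=1}^M$,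 $M\in\mathbb N$, with $q_i\ge 0$, $\sum_i q_i=1$, $\|\psi_i\|=1$ and $\rho=\sum_i q_i|\psi_i\rangle\langle\psi_i|$. The Schmidt vector of $\rho$ is $$\nu(\rho)=\bigvee\Big\{\sum_{i=1}^M q_i\,\mu^{\downarrow}(\psi_i)\;:\;M\in\mathbb N,\ \{q_i,|\psi_i\rangle\}_{i=1}^M\in\mathcal D(\rho)\Big\},$$ the supremum being taken in $(\Delta_d^{\downarrow},\preceq)$, and the Schmidt rank of $\rho$ is $\mathcal R(\rho)=\#\{i:\nu_i(\rho)\neq 0\}$. The state $\rho$ has Schmidt number $\mathcal N(\rho)=n$ if every decomposition in $\mathcal D(\rho)$ contains some $|\psi_{i}\rangle$ with $\mathcal R(\psi_{i})\ge n$, and there is a decomposition in $\mathcal D(\rho)$ with $\mathcal R(\psi_i)\le n$ for all $i$. **Theorem (Equivalence between Schmidt rank and Schmidt number).** For every bipartite state $\rho$, the supremum $\nu(\rho)$ exists, and $$\mathcal R(\rho)=\mathcal N(\rho)=\min_{\{q_i,|\psi_i\rangle\}_{i=1}^M\in\mathcal D(\rho)}\ \max_{1\le i\le M}\mathcal R(\psi_i).$$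 -/

import Mathlib

open scoped TensorProduct

noncomputable section

/-- The set of probability vectors of length `d` with non-increasing entries. -/
@[ext]
structure OrderedSimplex (d : ℕ) where
  toFun : Fin d → ℝ
  nonneg : ∀ i, 0 ≤ toFun i
  sum_eq_one : ∑ i, toFun i = 1
  antitone : Antitone toFun

namespace OrderedSimplex

/-- The sum of the first `k` entries. -/
def partialSum {d : ℕ} (u : OrderedSimplex d) (k : ℕ) : ℝ :=
  ∑ i ∈ Finset.univ.filter (fun i : Fin d => (i : ℕ) < k), u.toFun i

/-- The number of nonzero (equivalently, positive) entries. -/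
def supportCard {d : ℕ} (u : OrderedSimplex d) : ℕ :=
  (Finset.univ.filter fun i => u.toFun i ≠ 0).card

theorem partialSum_of_le {d : ℕ} (u : OrderedSimplex d) {k : ℕ} (hk : d ≤ k) :
    u.partialSum k = 1 := by
  unfold partialSum
  rw [Finset.filter_true_of_mem fun i _ => i.2.trans_le hk, u.sum_eq_one]

theorem partialSum_succ {d : ℕ} (u : OrderedSimplex d) (i : Fin d) :
    u.partialSum (i + 1) = u.partialSum i + u.toFun i := by
  unfold partialSum
  have h : (Finset.univ.filter fun j : Fin d => (j : ℕ) < (i : ℕ) + 1)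
      = insert i (Finset.univ.filter fun j : Fin d => (j : ℕ) < (i : ℕ)) := by
    ext j
    simp only [Finset.mem_filter, Finset.mem_univ, true_and, Finset.mem_insert, Fin.ext_iff]
    omega
  rw [h, Finset.sum_insert (by simp), add_comm]

/-- The majorization order: `u ≤ v` means that `u` is majorized by `v`. The entries are already
sorted non-increasingly, so the usual rearrangement is not needed, and the sums of all `d` entries
are both equal to one. -/
instance (d : ℕ) : PartialOrder (OrderedSimplex d) where
  le u v := ∀ k, k < d → u.partialSum k ≤ v.partialSum k
  le_refl _ _ _ := le_rfl
  le_trans _ _ _ h₁ h₂ k hk := (h₁ k hk).trans (h₂ k hk)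
  le_antisymm u v h₁ h₂ := by
    have h : ∀ k, u.partialSum k = v.partialSum k := fun k => by
      rcases lt_or_ge k d with hk | hk
      · exact le_antisymm (h₁ k hk) (h₂ k hk)
      · rw [u.partialSum_of_le hk, v.partialSum_of_le hk]
    ext i
    have hu := u.partialSum_succ i
    have hv := v.partialSum_succ i
    rw [h, h] at hu
    linarith

end OrderedSimplex

section Bipartite

variable {A B : Type*}
  [NormedAddCommGroup A] [InnerProductSpace ℂ A] [FiniteDimensional ℂ A]
  [NormedAddCommGroup B] [InnerProductSpace ℂ B] [FiniteDimensional ℂ B]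

/-- A bipartite state: a positive semidefinite operator on `A ⊗ B` with unit trace. -/
def IsBipartiteState (ρ : A ⊗[ℂ] B →ₗ[ℂ] A ⊗[ℂ] B) : Prop :=
  ρ.IsPositive ∧ LinearMap.trace ℂ (A ⊗[ℂ] B) ρ = 1

/-- The operator `|ψ⟩⟨ψ|`, that is, `φ ↦ ⟨ψ, φ⟩ ψ`. -/
def ketbra (ψ : A ⊗[ℂ] B) : A ⊗[ℂ] B →ₗ[ℂ] A ⊗[ℂ] B :=
  (InnerProductSpace.rankOne ℂ ψ ψ).toLinearMap

/-- The partial trace over the first factor: the linear map from operators on `A ⊗ B` to operators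
on `B` that sends `S ⊗ T` to `tr(S) T`. -/
def partialTraceLeft : (A ⊗[ℂ] B →ₗ[ℂ] A ⊗[ℂ] B) →ₗ[ℂ] (B →ₗ[ℂ] B) :=
  TensorProduct.lift ((LinearMap.lsmul ℂ (B →ₗ[ℂ] B)) ∘ₗ LinearMap.trace ℂ A) ∘ₗ
    (homTensorHomEquiv ℂ A B A B).symm.toLinearMap

theorem partialTraceLeft_map (S : A →ₗ[ℂ] A) (T : B →ₗ[ℂ] B) :
    partialTraceLeft (TensorProduct.map S T) = LinearMap.trace ℂ A S • T := by
  have h : (homTensorHomEquiv ℂ A B A B).symm (TensorProduct.map S T) = S ⊗ₜ[ℂ] T := by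
    rw [LinearEquiv.symm_apply_eq, homTensorHomEquiv_apply]
    simp
  simp [partialTraceLeft, h]

/-- The Schmidt rank of `|ψ⟩⟨ψ|`: the rank of its reduced operator. -/
def pureSchmidtRank (ψ : A ⊗[ℂ] B) : ℕ :=
  Module.finrank ℂ (LinearMap.range (partialTraceLeft (ketbra ψ)))

/-- `μ` is the sorted Schmidt vector of `ψ`, of length `d = min (dim A) (dim B)`:
`ψ = ∑ i, √(μ i) a i ⊗ b i` for orthonormal families `a` in `A` and `b` in `B`. -/
def IsSortedSchmidtVector (ψ : A ⊗[ℂ] B)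
    (μ : OrderedSimplex (min (Module.finrank ℂ A) (Module.finrank ℂ B))) : Prop :=
  ∃ (a : Fin (min (Module.finrank ℂ A) (Module.finrank ℂ B)) → A)
    (b : Fin (min (Module.finrank ℂ A) (Module.finrank ℂ B)) → B),
    Orthonormal ℂ a ∧ Orthonormal ℂ b ∧
      ψ = ∑ i, ((√(μ.toFun i) : ℝ) : ℂ) • (a i ⊗ₜ[ℂ] b i)

/-- `{q i, ψ i}` is a (finite) pure-state decomposition of `ρ`: the `q i` are probabilities, the
`ψ i` are unit vectors and `ρ = ∑ i, q i |ψ i⟩⟨ψ i|`. -/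
structure IsPureDecomposition (ρ : A ⊗[ℂ] B →ₗ[ℂ] A ⊗[ℂ] B) {M : ℕ}
    (q : Fin M → ℝ) (ψ : Fin M → A ⊗[ℂ] B) : Prop where
  nonneg : ∀ i, 0 ≤ q i
  sum_eq_one : ∑ i, q i = 1
  norm_eq_one : ∀ i, ‖ψ i‖ = 1
  eq_sum : ρ = ∑ i, (q i : ℂ) • ketbra (ψ i)

/-- The set of averaged sorted Schmidt vectors `∑ i, q i μ↓(ψ i)` over all pure-state
decompositions `{q i, ψ i}` of `ρ`. -/
def averagedSchmidtVectors (ρ : A ⊗[ℂ] B →ₗ[ℂ] A ⊗[ℂ] B) :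
    Set (OrderedSimplex (min (Module.finrank ℂ A) (Module.finrank ℂ B))) :=
  {u | ∃ (M : ℕ) (q : Fin M → ℝ) (ψ : Fin M → A ⊗[ℂ] B)
      (μ : Fin M → OrderedSimplex (min (Module.finrank ℂ A) (Module.finrank ℂ B))),
      IsPureDecomposition ρ q ψ ∧ (∀ i, IsSortedSchmidtVector (ψ i) (μ i)) ∧
        ∀ j, u.toFun j = ∑ i, q i * (μ i).toFun j}

/-- `ν` is the Schmidt vector of the state `ρ`: the supremum, in the majorization order, of the
averaged sorted Schmidt vectors. -/
def IsSchmidtVector (ρ : A ⊗[ℂ] B →ₗ[ℂ] A ⊗[ℂ] B)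
    (ν : OrderedSimplex (min (Module.finrank ℂ A) (Module.finrank ℂ B))) : Prop :=
  IsLUB (averagedSchmidtVectors ρ) ν

/-- `ρ` has Schmidt number `n`: every pure-state decomposition contains a vector of Schmidt rank at
least `n`, and in some pure-state decomposition all vectors have Schmidt rank at most `n`. -/
def HasSchmidtNumber (ρ : A ⊗[ℂ] B →ₗ[ℂ] A ⊗[ℂ] B) (n : ℕ) : Prop :=
  (∀ (M : ℕ) (q : Fin M → ℝ) (ψ : Fin M → A ⊗[ℂ] B), IsPureDecomposition ρ q ψ →
      ∃ i, n ≤ pureSchmidtRank (ψ i)) ∧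
    ∃ (M : ℕ) (q : Fin M → ℝ) (ψ : Fin M → A ⊗[ℂ] B), IsPureDecomposition ρ q ψ ∧
      ∀ i, pureSchmidtRank (ψ i) ≤ n

/-- The values `max i, R(ψ i)` over all pure-state decompositions `{q i, ψ i}` of `ρ`. -/
def maxSchmidtRanks (ρ : A ⊗[ℂ] B →ₗ[ℂ] A ⊗[ℂ] B) : Set ℕ :=
  {m | ∃ (M : ℕ) (q : Fin M → ℝ) (ψ : Fin M → A ⊗[ℂ] B), IsPureDecomposition ρ q ψ ∧
    m = Finset.univ.sup fun i => pureSchmidtRank (ψ i)}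

end Bipartite

end

/-! A sorted probability vector is the same thing as a concave nondecreasing sequence of partial
sums running from 0 to 1, and majorization is the pointwise order on these sequences. It has at most
`n` nonzero entries exactly when its `n`-th partial sum is 1. If all vectors of a decomposition have
Schmidt rank at most `n`, its averaged Schmidt vector has `n`-th partial sum 1, hence so does the
supremum ν. This gives R(ρ) ≤ n (`IsSchmidtVector.supportCard_le`). Conversely, let n = R(ρ). The
supremum need not be attained, and the join is not computed pointwise, because a pointwise supremum
of concave sequences need not be concave. Still, if the `n`-th partial sum of ν is 1, some averaged
vectors have `n`-th partial sum arbitrarily close to 1 (`exists_lt_partialSum`). Cutting their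
Schmidt decompositions to `n` terms approximates ρ by convex combinations of |φ⟩⟨φ| with φ of
Schmidt rank at most `n` (`exists_approx_of_lt_partialSum`). Such φ range over a compact set, and
Carathéodory's theorem bounds the number of terms, so the limit ρ is itself a sum of such operators
(`exists_eq_sum_rankOne_of_approx`). Normalizing the terms yields a decomposition of rank at most
`n`. -/

noncomputable section

/-! ### Suprema in the majorization order -/

namespace OrderedSimplex

variable {d : ℕ}

/-- The ordered probability vector with prescribed partial sums. -/
def ofPartialSums (s : ℕ → ℝ) (h0 : s 0 = 0) (h1 : s d = 1) (mono : ∀ k, s k ≤ s (k + 1))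
    (conc : ∀ k, s (k + 2) + s k ≤ 2 * s (k + 1)) : OrderedSimplex d where
  toFun i := s (i + 1) - s i
  nonneg i := sub_nonneg.2 (mono i)
  sum_eq_one := by
    rw [Fin.sum_univ_eq_sum_range (fun i => s (i + 1) - s i), Finset.sum_range_sub, h0, h1,
      sub_zero]
  antitone i j hij := by
    have : Antitone fun k : ℕ => s (k + 1) - s k :=
      antitone_nat_of_succ_le fun k => by
        have := conc k
        change s (k + 2) - s (k + 1) ≤ s (k + 1) - s k
        linarith
    exact this hij

theorem partialSum_zero (u : OrderedSimplex d) : u.partialSum 0 = 0 := by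
  simp [partialSum]

theorem partialSum_ofPartialSums {s : ℕ → ℝ} {h0 : s 0 = 0} {h1 : s d = 1}
    {mono : ∀ k, s k ≤ s (k + 1)} {conc : ∀ k, s (k + 2) + s k ≤ 2 * s (k + 1)} {k : ℕ}
    (hk : k ≤ d) : (ofPartialSums s h0 h1 mono conc).partialSum k = s k := by
  induction k with
  | zero => rw [partialSum_zero, h0]
  | succ k ih =>
    have := (ofPartialSums s h0 h1 mono conc).partialSum_succ ⟨k, hk⟩
    simp only at this
    rw [this, ih (by omega)]
    simp [ofPartialSums]

theorem partialSum_mono (u : OrderedSimplex d) : Monotone u.partialSum := fun k l h =>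
  Finset.sum_le_sum_of_subset_of_nonneg
    (fun i hi => by simp only [Finset.mem_filter, Finset.mem_univ, true_and] at hi ⊢; omega)
    fun i _ _ => u.nonneg i

theorem partialSum_nonneg (u : OrderedSimplex d) (k : ℕ) : 0 ≤ u.partialSum k :=
  Finset.sum_nonneg fun i _ => u.nonneg i

theorem partialSum_le_one (u : OrderedSimplex d) (k : ℕ) : u.partialSum k ≤ 1 := by
  rw [← u.sum_eq_one]
  exact Finset.sum_le_sum_of_subset_of_nonneg (Finset.filter_subset _ _) fun i _ _ => u.nonneg i

theorem partialSum_concave (u : OrderedSimplex d) (k : ℕ) :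
    u.partialSum (k + 2) + u.partialSum k ≤ 2 * u.partialSum (k + 1) := by
  rcases lt_or_ge (k + 1) d with h | h
  · have h1 := u.partialSum_succ ⟨k, by omega⟩
    have h2 := u.partialSum_succ ⟨k + 1, h⟩
    have h3 := u.antitone (show (⟨k, by omega⟩ : Fin d) ≤ ⟨k + 1, h⟩ by simp [Fin.le_def])
    simp only at h1 h2
    rw [show k + 2 = k + 1 + 1 from rfl]
    linarith
  · rw [u.partialSum_of_le h, u.partialSum_of_le (by omega : d ≤ k + 2)]
    linarith [u.partialSum_le_one k]

theorem partialSum_le_of_le {u v : OrderedSimplex d} (h : u ≤ v) (k : ℕ) :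
    u.partialSum k ≤ v.partialSum k := by
  rcases lt_or_ge k d with hk | hk
  · exact h k hk
  · rw [u.partialSum_of_le hk, v.partialSum_of_le hk]

/-- Every nonempty family of ordered probability vectors has an infimum in the majorization
order. -/
theorem exists_isGLB {U : Set (OrderedSimplex d)} (hU : U.Nonempty) : ∃ ν, IsGLB U ν := by
  have : Nonempty U := hU.to_subtype
  -- Monotonicity and concavity survive a pointwise infimum; concavity is what makes the increments
  -- sorted.
  let s : ℕ → ℝ := fun k => ⨅ v : U, v.1.partialSum k
  have bdd : ∀ k, BddBelow (Set.range fun v : U => v.1.partialSum k) := fun k =>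
    ⟨0, by rintro _ ⟨v, rfl⟩; exact v.1.partialSum_nonneg k⟩
  have hs : ∀ k (v : U), s k ≤ v.1.partialSum k := fun k v => ciInf_le (bdd k) v
  have h0 : s 0 = 0 := by simp [s, partialSum_zero]
  have h1 : s d = 1 := by simp [s, partialSum_of_le]
  have mono : ∀ k, s k ≤ s (k + 1) := fun k =>
    le_ciInf fun v => (hs k v).trans (v.1.partialSum_mono k.le_succ)
  have conc : ∀ k, s (k + 2) + s k ≤ 2 * s (k + 1) := fun k => by
    have : (s (k + 2) + s k) / 2 ≤ s (k + 1) := le_ciInf fun v => by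
      linarith [hs (k + 2) v, hs k v, v.1.partialSum_concave k]
    linarith
  refine ⟨ofPartialSums s h0 h1 mono conc, fun v hv k hk => ?_, fun w hw k hk => ?_⟩
  · rw [partialSum_ofPartialSums hk.le]
    exact hs k ⟨v, hv⟩
  · rw [partialSum_ofPartialSums hk.le]
    exact le_ciInf fun v => hw v.2 k hk

/-- For small `t`, the ordered probability vector whose `k`-th partial sum, for `k ≥ 1`, is
`min 1 (1 - (n + 1 - k) t)`. -/
theorem exists_partialSum_eq_min {n : ℕ} (hn : n < d) {t : ℝ} (ht : 0 ≤ t)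
    (ht1 : (n + 1) * t ≤ 1) : ∃ v : OrderedSimplex d,
      ∀ k ≤ d, v.partialSum k = min (k : ℝ) (min 1 (1 - (n + 1 - k) * t)) := by
  have hd : (n : ℝ) + 1 ≤ d := by exact_mod_cast hn
  have hn0 : (0 : ℝ) ≤ n := n.cast_nonneg
  -- A minimum of affine functions of `k` is concave. The term `k` only forces the value 0 at 0.
  let s : ℕ → ℝ := fun k => min (k : ℝ) (min 1 (1 - (n + 1 - k) * t))
  have h0 : s 0 = 0 := by
    simp only [s, Nat.cast_zero]
    exact min_eq_left (le_min zero_le_one (by simpa using ht1))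
  have h1 : s d = 1 := by
    simp only [s]
    rw [min_eq_left (a := (1 : ℝ)) (by nlinarith), min_eq_right (by linarith)]
  refine ⟨ofPartialSums s h0 h1 (fun k => ?_) fun k => ?_, fun k hk =>
    partialSum_ofPartialSums hk⟩
  · refine min_le_min (by push_cast; linarith) (min_le_min le_rfl ?_)
    push_cast
    nlinarith
  · have e : ∀ k, s k ≤ k ∧ s k ≤ 1 ∧ s k ≤ 1 - (n + 1 - k) * t := fun k =>
      ⟨min_le_left _ _, (min_le_right _ _).trans (min_le_left _ _),
        (min_le_right _ _).trans (min_le_right _ _)⟩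
    have : (s (k + 2) + s k) / 2 ≤ s (k + 1) := by
      obtain ⟨a1, a2, a3⟩ := e k
      obtain ⟨b1, b2, b3⟩ := e (k + 2)
      push_cast at b1 b2 b3
      refine le_min ?_ (le_min ?_ ?_)
      · push_cast; linarith
      · linarith
      · push_cast; linarith
    linarith

/-- Every nonempty family of ordered probability vectors has a supremum in the majorization
order. -/
theorem exists_isLUB {S : Set (OrderedSimplex d)} (hS : S.Nonempty) : ∃ ν, IsLUB S ν := by
  obtain ⟨u, -⟩ := hS
  have hd : 0 < d := by
    rcases Nat.eq_zero_or_pos d with rfl | h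
    · have := u.sum_eq_one
      simp at this
    · exact h
  -- With `t = 0` this is (1, 0, ..., 0), the greatest element.
  obtain ⟨v, hv⟩ := exists_partialSum_eq_min hd le_rfl (by simp)
  have hU : (upperBounds S).Nonempty := ⟨v, fun w _ k hk => by
    rw [hv k hk.le]
    rcases Nat.eq_zero_or_pos k with rfl | h
    · simp [partialSum_zero]
    · have : (1 : ℝ) ≤ k := by exact_mod_cast h
      simpa [this] using w.partialSum_le_one k⟩
  obtain ⟨ν, hν⟩ := exists_isGLB hU
  exact ⟨ν, isGLB_upperBounds.1 hν⟩

/-- If the `n`-th partial sum of a supremum is one, then so is the supremum of the `n`-th partial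
sums. -/
theorem exists_lt_partialSum {S : Set (OrderedSimplex d)} (hS : S.Nonempty) {ν : OrderedSimplex d}
    (hν : IsLUB S ν) {n : ℕ} (hn : ν.partialSum n = 1) {δ : ℝ} (hδ : 0 < δ) :
    ∃ u ∈ S, 1 - δ < u.partialSum n := by
  by_contra! h
  have hnd : n < d := by
    by_contra! hnd
    obtain ⟨u, hu⟩ := hS
    have := h u hu
    rw [u.partialSum_of_le hnd] at this
    linarith
  have hn0 : (0 : ℝ) ≤ n := n.cast_nonneg
  have hpos : (0 : ℝ) < n + 1 := by linarith
  -- Here `(n + 1) * t = min δ 1`: the bound by 1 makes `v` exist, and the bound by `δ` makes `v`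
  -- dominate `S` at each `k ≤ n`. The `n`-th partial sum of `v` is at most `1 - t < 1`, so `v` is
  -- an upper bound that is not above `ν`.
  let t : ℝ := min δ 1 / (n + 1)
  have ht : 0 < t := by positivity
  have htn : (n + 1) * t = min δ 1 := mul_div_cancel₀ _ hpos.ne'
  obtain ⟨v, hv⟩ := exists_partialSum_eq_min hnd ht.le (htn.le.trans (min_le_right _ _))
  have hvS : v ∈ upperBounds S := fun u hu k hk => by
    rw [hv k hk.le]
    rcases Nat.eq_zero_or_pos k with rfl | h0
    · rw [partialSum_zero]
      refine le_min (by simp) (le_min zero_le_one ?_)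
      have := htn.le.trans (min_le_right _ _)
      simpa using this
    · have h1 : (1 : ℝ) ≤ k := by exact_mod_cast h0
      refine le_min ((u.partialSum_le_one k).trans h1) (le_min (u.partialSum_le_one k) ?_)
      rcases le_or_gt k n with hkn | hkn
      · have h2 := (u.partialSum_mono hkn).trans (h u hu)
        have h3 := htn.le.trans (min_le_left _ _)
        nlinarith
      · have h2 : (n : ℝ) + 1 ≤ k := by exact_mod_cast hkn
        nlinarith [u.partialSum_le_one k]
  have h1 := hν.2 hvS n hnd
  rw [hn, hv n hnd.le] at h1
  have h2 := h1.trans ((min_le_right _ _).trans (min_le_right _ _))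
  linarith

theorem partialSum_supportCard (u : OrderedSimplex d) : u.partialSum u.supportCard = 1 := by
  rw [← u.sum_eq_one, partialSum, Finset.sum_filter_of_ne]
  intro i _ hi
  -- By sortedness, all entries before a nonzero one are nonzero, so its index is below their
  -- number.
  have hsub : Finset.Iic i ⊆ Finset.univ.filter fun j => u.toFun j ≠ 0 := fun j hj => by
    simp only [Finset.mem_filter, Finset.mem_univ, true_and]
    have h1 := u.antitone (Finset.mem_Iic.1 hj)
    have h2 := (u.nonneg i).lt_of_ne' hi
    linarith
  have := Finset.card_le_card hsub
  rw [Fin.card_Iic] at this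
  exact this

theorem supportCard_le_of_partialSum_eq_one (u : OrderedSimplex d) {k : ℕ}
    (h : u.partialSum k = 1) : u.supportCard ≤ k := by
  have hz : ∀ i : Fin d, ¬ (i : ℕ) < k → u.toFun i = 0 := by
    have h1 := Finset.sum_filter_add_sum_filter_not Finset.univ (fun i : Fin d => (i : ℕ) < k)
      u.toFun
    rw [u.sum_eq_one] at h1
    have h2 : ∑ i ∈ Finset.univ.filter (fun i : Fin d => ¬ (i : ℕ) < k), u.toFun i = 0 := by
      rw [partialSum] at h
      linarith
    rw [Finset.sum_eq_zero_iff_of_nonneg fun i _ => u.nonneg i] at h2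
    exact fun i hi => h2 i (by simpa using hi)
  calc u.supportCard ≤ (Finset.univ.filter fun i : Fin d => (i : ℕ) < k).card :=
        Finset.card_le_card fun i hi => by
          simp only [Finset.mem_filter, Finset.mem_univ, true_and] at hi ⊢
          by_contra hik
          exact hi (hz i hik)
    _ ≤ k := by
      rw [Fin.card_filter_val_lt]
      exact min_le_right _ _

theorem supportCard_pos (u : OrderedSimplex d) : 0 < u.supportCard := by
  by_contra! h
  have := u.partialSum_supportCard
  rw [Nat.le_zero.1 h, partialSum_zero] at this
  exact zero_ne_one this

end OrderedSimplex

/-! ### Reduced operators and the Schmidt decomposition -/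

section Tensor

open InnerProductSpace

variable {A B : Type*}
  [NormedAddCommGroup A] [InnerProductSpace ℂ A]
  [NormedAddCommGroup B] [InnerProductSpace ℂ B]

theorem exists_eq_sum_tmul_basis {ι : Type*} [Fintype ι] (f : Module.Basis ι ℂ B) (ψ : A ⊗[ℂ] B) :
    ∃ x : ι → A, ψ = ∑ i, x i ⊗ₜ[ℂ] f i := by
  induction ψ with
  | zero => exact ⟨0, by simp⟩
  | add ψ φ hψ hφ =>
    obtain ⟨x, rfl⟩ := hψ
    obtain ⟨y, rfl⟩ := hφ
    exact ⟨x + y, by simp [TensorProduct.add_tmul, Finset.sum_add_distrib]⟩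
  | tmul a b =>
    refine ⟨fun i => f.repr b i • a, ?_⟩
    conv_lhs => rw [← f.sum_repr b]
    simp only [TensorProduct.tmul_sum, TensorProduct.smul_tmul]

theorem Orthonormal.tmul_self_index {ι : Type*} {a : ι → A} {b : ι → B} (ha : Orthonormal ℂ a)
    (hb : Orthonormal ℂ b) : Orthonormal ℂ fun i => a i ⊗ₜ[ℂ] b i :=
  (ha.tmul hb).comp (fun i => (i, i)) fun _ _ h => congrArg Prod.fst h

theorem Orthonormal.norm_sum_smul_sq {ι E : Type*} [NormedAddCommGroup E] [InnerProductSpace ℂ E]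
    {v : ι → E} (hv : Orthonormal ℂ v) (c : ι → ℂ) (s : Finset ι) :
    ‖∑ i ∈ s, c i • v i‖ ^ 2 = ∑ i ∈ s, ‖c i‖ ^ 2 := by
  have h := hv.inner_sum c c s
  rw [inner_self_eq_norm_sq_to_K] at h
  have h2 : ∀ i, (starRingEnd ℂ) (c i) * c i = ((‖c i‖ ^ 2 : ℝ) : ℂ) := fun i => by
    rw [Complex.conj_mul']
    push_cast
    rfl
  simp only [h2] at h
  exact Complex.ofReal_injective (by push_cast at h ⊢; exact h)

theorem rankOne_tmul (a a' : A) (b b' : B) :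
    (rankOne ℂ (a ⊗ₜ[ℂ] b) (a' ⊗ₜ[ℂ] b')).toLinearMap =
      TensorProduct.map (rankOne ℂ a a').toLinearMap (rankOne ℂ b b').toLinearMap := by
  ext x y
  simp [TensorProduct.smul_tmul', TensorProduct.tmul_smul, smul_smul, mul_comm]

theorem ketbra_smul (c : ℂ) (ψ : A ⊗[ℂ] B) :
    ketbra (c • ψ) = (starRingEnd ℂ c * c) • ketbra ψ := by
  refine LinearMap.ext fun φ => ?_
  have hin : inner ℂ (c • ψ) φ = starRingEnd ℂ c * inner ℂ ψ φ :=
    inner_smul_left (E := A ⊗[ℂ] B) ψ φ c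
  simp only [ketbra, ContinuousLinearMap.coe_coe, LinearMap.smul_apply, rankOne_apply,
    smul_smul, hin]
  congr 1
  ring

variable [FiniteDimensional ℂ A] [FiniteDimensional ℂ B]

/-- No orthogonality is assumed, so the formula serves both for rank bounds on arbitrary tensor sums
and for constructing the Schmidt decomposition. -/
theorem partialTraceLeft_ketbra_sum_tmul {ι : Type*} (s : Finset ι) (a : ι → A) (b : ι → B)
    (y : B) :
    partialTraceLeft (ketbra (∑ i ∈ s, a i ⊗ₜ[ℂ] b i)) y =
      ∑ i ∈ s, ∑ j ∈ s, (inner ℂ (a j) (a i) * inner ℂ (b j) y) • b i := by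
  have h : ketbra (∑ i ∈ s, a i ⊗ₜ[ℂ] b i) = ∑ i ∈ s, ∑ j ∈ s,
      TensorProduct.map (rankOne ℂ (a i) (a j)).toLinearMap (rankOne ℂ (b i) (b j)).toLinearMap := by
    simp only [← rankOne_tmul, ketbra, map_sum, _root_.sum_apply,
      ContinuousLinearMap.toLinearMap_sum]
    exact Finset.sum_comm
  simp [h, partialTraceLeft_map, trace_rankOne, mul_smul]

/-- The range of the reduced operator lies in the span of the second factors. -/
theorem pureSchmidtRank_sum_tmul_le {ι : Type*} (s : Finset ι) (a : ι → A) (b : ι → B) :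
    pureSchmidtRank (∑ i ∈ s, a i ⊗ₜ[ℂ] b i) ≤ s.card := by
  classical
  have : LinearMap.range (partialTraceLeft (ketbra (∑ i ∈ s, a i ⊗ₜ[ℂ] b i))) ≤
      Submodule.span ℂ (s.image b : Set B) := by
    rintro _ ⟨y, rfl⟩
    rw [partialTraceLeft_ketbra_sum_tmul]
    exact Submodule.sum_mem _ fun i hi => Submodule.sum_mem _ fun j _ =>
      Submodule.smul_mem _ _ (Submodule.subset_span (Finset.mem_coe.2
        (Finset.mem_image_of_mem b hi)))
  exact (Submodule.finrank_mono this).trans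
    ((finrank_span_finset_le_card _).trans Finset.card_image_le)

theorem pureSchmidtRank_smul_le (c : ℂ) (ψ : A ⊗[ℂ] B) :
    pureSchmidtRank (c • ψ) ≤ pureSchmidtRank ψ := by
  refine Submodule.finrank_mono ?_
  rintro _ ⟨y, rfl⟩
  rw [ketbra_smul, map_smul]
  exact Submodule.smul_mem _ _ ⟨y, rfl⟩

/-- The number of nonzero Schmidt coefficients is the Schmidt rank. -/
theorem IsSortedSchmidtVector.supportCard_eq {ψ : A ⊗[ℂ] B}
    {μ : OrderedSimplex (min (Module.finrank ℂ A) (Module.finrank ℂ B))}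
    (h : IsSortedSchmidtVector ψ μ) : μ.supportCard = pureSchmidtRank ψ := by
  classical
  obtain ⟨a, b, ha, hb, rfl⟩ := h
  set s := Finset.univ.filter fun i => μ.toFun i ≠ 0
  have hψ : ∑ i, ((√(μ.toFun i) : ℝ) : ℂ) • (a i ⊗ₜ[ℂ] b i) =
      ∑ i, (((√(μ.toFun i) : ℝ) : ℂ) • a i) ⊗ₜ[ℂ] b i := by
    simp only [TensorProduct.smul_tmul']
  rw [hψ]
  -- Orthonormality of `a` kills the cross terms, so the reduced operator is diagonal along `b` with
  -- eigenvalues `μ i`.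
  have key : ∀ y, partialTraceLeft (ketbra (∑ i, (((√(μ.toFun i) : ℝ) : ℂ) • a i) ⊗ₜ[ℂ] b i)) y =
      ∑ i, ((μ.toFun i : ℂ) * inner ℂ (b i) y) • b i := fun y => by
    rw [partialTraceLeft_ketbra_sum_tmul]
    refine Finset.sum_congr rfl fun i _ => ?_
    rw [Finset.sum_eq_single i]
    · rw [inner_smul_left, inner_smul_right, inner_self_eq_norm_sq_to_K, ha.1, Complex.conj_ofReal,
        ← mul_assoc, ← Complex.ofReal_mul, Real.mul_self_sqrt (μ.nonneg i)]
      simp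
    · intro j _ hji
      simp [ha.2 hji]
    · simp
  have hrange : LinearMap.range
      (partialTraceLeft (ketbra (∑ i, (((√(μ.toFun i) : ℝ) : ℂ) • a i) ⊗ₜ[ℂ] b i))) =
      Submodule.span ℂ (Set.range fun i : s => b i) := by
    apply le_antisymm
    · rintro _ ⟨y, rfl⟩
      rw [key]
      refine Submodule.sum_mem _ fun i _ => ?_
      by_cases hi : μ.toFun i = 0
      · simp [hi]
      · exact Submodule.smul_mem _ _ (Submodule.subset_span ⟨⟨i, by simp [s, hi]⟩, rfl⟩)
    · rw [Submodule.span_le]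
      rintro _ ⟨⟨i, hi⟩, rfl⟩
      have hi : μ.toFun i ≠ 0 := by simpa [s] using hi
      refine ⟨((μ.toFun i)⁻¹ : ℂ) • b i, ?_⟩
      rw [map_smul, key, Finset.sum_eq_single i]
      · rw [inner_self_eq_norm_sq_to_K, hb.1]
        simp only [Complex.coe_algebraMap, Complex.ofReal_one, one_pow, mul_one, smul_smul]
        rw [inv_mul_cancel₀ (Complex.ofReal_ne_zero.2 hi), one_smul]
      · intro j _ hji
        simp [hb.2 hji]
      · simp
  have hli : LinearIndependent ℂ fun i : s => b i :=
    hb.linearIndependent.comp _ Subtype.val_injective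
  rw [pureSchmidtRank, hrange, finrank_span_eq_card hli, Fintype.card_coe]
  rfl

theorem isSymmetric_partialTraceLeft_ketbra (ψ : A ⊗[ℂ] B) :
    (partialTraceLeft (ketbra ψ)).IsSymmetric := by
  obtain ⟨x, rfl⟩ := exists_eq_sum_tmul_basis (Module.finBasis ℂ B) ψ
  intro y z
  rw [partialTraceLeft_ketbra_sum_tmul, partialTraceLeft_ketbra_sum_tmul]
  simp only [sum_inner, inner_sum, inner_smul_left, inner_smul_right, map_mul, inner_conj_symm]
  rw [Finset.sum_comm]
  exact Finset.sum_congr rfl fun i _ => Finset.sum_congr rfl fun j _ => by ring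

/-- A bipartite vector is a combination of an orthonormal basis of the second factor with
coefficients in the first factor that are mutually orthogonal and sorted by norm. -/
theorem exists_orthogonal_expansion (ψ : A ⊗[ℂ] B) :
    ∃ (x : Fin (Module.finrank ℂ B) → A) (f : OrthonormalBasis (Fin (Module.finrank ℂ B)) ℂ B),
      Pairwise (fun i j => inner ℂ (x i) (x j) = 0) ∧ (Antitone fun i => ‖x i‖ ^ 2) ∧
        ψ = ∑ i, x i ⊗ₜ[ℂ] f i := by
  have hs := isSymmetric_partialTraceLeft_ketbra ψ
  let f := hs.eigenvectorBasis rfl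
  obtain ⟨x, hx⟩ := exists_eq_sum_tmul_basis f.toBasis ψ
  simp only [OrthonormalBasis.coe_toBasis] at hx
  -- The Gram matrix of the coefficients `x` is the matrix of the reduced operator in `f`. In an
  -- eigenbasis it is diagonal, so the `x i` are orthogonal with squared norms the sorted
  -- eigenvalues.
  have key : ∀ i k, inner ℂ (x k) (x i) = if i = k then (hs.eigenvalues rfl k : ℂ) else 0 := by
    intro i k
    have h1 := hs.apply_eigenvectorBasis rfl k
    have h2 := partialTraceLeft_ketbra_sum_tmul Finset.univ x f (f k)
    rw [← hx, h1] at h2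
    have h3 := congrArg (fun y => inner ℂ (f i) y) h2
    simp only [inner_smul_right, inner_sum] at h3
    change _ * inner ℂ (f i) (f k) = _ at h3
    simp only [f.inner_eq_ite] at h3
    simpa using h3.symm
  refine ⟨x, f, fun i j hij => (key j i).trans (if_neg hij.symm), fun i j hij => ?_, hx⟩
  have h : ∀ i, ‖x i‖ ^ 2 = hs.eigenvalues rfl i := fun i => by
    have := key i i
    rw [if_pos rfl, inner_self_eq_norm_sq_to_K] at this
    exact Complex.ofReal_injective (by push_cast; exact this)
  simp only [h]
  exact hs.eigenvalues_antitone rfl hij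

/-- The Schmidt decomposition. -/
theorem exists_isSortedSchmidtVector {ψ : A ⊗[ℂ] B} (hψ : ‖ψ‖ = 1) :
    ∃ μ, IsSortedSchmidtVector ψ μ := by
  classical
  obtain ⟨x, f, hx, hanti, hsum⟩ := exists_orthogonal_expansion ψ
  -- Otherwise sortedness would give `j + 1 > dim A` nonzero, mutually orthogonal vectors in `A`.
  have hzero : ∀ j : Fin (Module.finrank ℂ B), Module.finrank ℂ A ≤ j → x j = 0 := by
    intro j hj
    by_contra hne
    have hne' : ∀ i : Fin (j + 1), x (Fin.castLE j.2 i) ≠ 0 := fun i hi => by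
      have h1 := hanti (show Fin.castLE j.2 i ≤ j from Nat.lt_succ_iff.1 i.2)
      simp only [hi, norm_zero] at h1
      have : 0 < ‖x j‖ := norm_pos_iff.2 hne
      nlinarith
    have hli := linearIndependent_of_ne_zero_of_inner_eq_zero (𝕜 := ℂ) hne' fun i k hik =>
      hx fun h => hik (Fin.castLE_injective _ h)
    have := hli.fintype_card_le_finrank
    rw [Fintype.card_fin] at this
    omega
  set d := min (Module.finrank ℂ A) (Module.finrank ℂ B) with hd
  let ιA : Fin d → Fin (Module.finrank ℂ A) := Fin.castLE (min_le_left _ _)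
  let ιB : Fin d → Fin (Module.finrank ℂ B) := Fin.castLE (min_le_right _ _)
  -- Normalized coefficients, with value 0 where `x` vanishes or is not indexed. Only the nonzero
  -- ones are kept in `s`; extending them to an orthonormal basis of `A` supplies the vectors that
  -- accompany zero Schmidt coefficients.
  let v : Fin (Module.finrank ℂ A) → A := fun i =>
    if h : (i : ℕ) < Module.finrank ℂ B then ((‖x ⟨i, h⟩‖⁻¹ : ℝ) : ℂ) • x ⟨i, h⟩ else 0
  let s : Set (Fin (Module.finrank ℂ A)) := {i | v i ≠ 0}
  have hv : Orthonormal ℂ (s.domRestrict v) := by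
    constructor
    · rintro ⟨i, hi⟩
      have hi : v i ≠ 0 := hi
      simp only [Set.domRestrict_apply, v] at hi ⊢
      split_ifs at hi ⊢ with h
      · have h0 : x ⟨i, h⟩ ≠ 0 := fun h0 => hi (by simp [h0])
        rw [norm_smul, Complex.norm_real, norm_inv, norm_norm,
          inv_mul_cancel₀ (norm_ne_zero_iff.2 h0)]
      · exact absurd rfl hi
    · rintro ⟨i, hi⟩ ⟨j, hj⟩ hij
      simp only [Set.domRestrict_apply, v]
      split_ifs with h h'
      · rw [inner_smul_left, inner_smul_right, hx, mul_zero, mul_zero]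
        intro h2
        apply hij
        simp only [Fin.mk.injEq] at h2
        exact Subtype.ext (Fin.ext h2)
      all_goals simp
  obtain ⟨a, ha⟩ := hv.exists_orthonormalBasis_extension_of_card_eq
    (Fintype.card_fin _).symm
  have hax : ∀ i : Fin d, x (ιB i) = ((‖x (ιB i)‖ : ℝ) : ℂ) • a (ιA i) := fun i => by
    by_cases h0 : x (ιB i) = 0
    · simp [h0]
    · have hvi : v (ιA i) = ((‖x (ιB i)‖⁻¹ : ℝ) : ℂ) • x (ιB i) :=
        dif_pos (i.2.trans_le (min_le_right _ _))
      have hmem : ιA i ∈ s := by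
        change v (ιA i) ≠ 0
        rw [hvi]
        exact smul_ne_zero (by simpa using h0) h0
      rw [ha _ hmem, hvi, smul_smul, ← Complex.ofReal_mul,
        mul_inv_cancel₀ (norm_ne_zero_iff.2 h0), Complex.ofReal_one, one_smul]
  have hψsum : ψ = ∑ i : Fin d, ((‖x (ιB i)‖ : ℝ) : ℂ) • (a (ιA i) ⊗ₜ[ℂ] f (ιB i)) := by
    have h1 : ∀ i : Fin d, ((‖x (ιB i)‖ : ℝ) : ℂ) • (a (ιA i) ⊗ₜ[ℂ] f (ιB i)) =
        x (ιB i) ⊗ₜ[ℂ] f (ιB i) := fun i => by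
      rw [TensorProduct.smul_tmul', ← hax]
    have hinj : Function.Injective ιB := Fin.castLE_injective _
    rw [hsum, Finset.sum_congr rfl fun i _ => h1 i,
      ← Finset.sum_image (f := fun j => x j ⊗ₜ[ℂ] f j) (fun i _ j _ h => hinj h)]
    symm
    refine Finset.sum_subset (Finset.subset_univ _) fun j _ hj => ?_
    rw [hzero j, TensorProduct.zero_tmul]
    by_contra! hjA
    exact hj (Finset.mem_image.2 ⟨⟨j, lt_min hjA j.2⟩, Finset.mem_univ _, rfl⟩)
  have haι : Orthonormal ℂ fun i => a (ιA i) := a.orthonormal.comp _ (Fin.castLE_injective _)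
  have hfι : Orthonormal ℂ fun i => f (ιB i) := f.orthonormal.comp _ (Fin.castLE_injective _)
  refine ⟨⟨fun i => ‖x (ιB i)‖ ^ 2, fun i => by positivity, ?_, fun i j hij => hanti ?_⟩,
    fun i => a (ιA i), fun i => f (ιB i), haι, hfι, ?_⟩
  · have := (haι.tmul_self_index hfι).norm_sum_smul_sq (fun i => ((‖x (ιB i)‖ : ℝ) : ℂ)) Finset.univ
    rw [← hψsum, hψ] at this
    simpa using this.symm
  · exact hij
  · simpa only [Real.sqrt_sq (norm_nonneg _)] using hψsum

end Tensor

/-! ### Limits of convex combinations of rank-one operators -/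

section Compactness

open InnerProductSpace

variable {V : Type*} [NormedAddCommGroup V] [InnerProductSpace ℂ V]

theorem norm_rankOne_self_sub_le (x y : V) :
    ‖rankOne ℂ x x - rankOne ℂ y y‖ ≤ ‖x - y‖ * (‖x‖ + ‖y‖) := by
  have h : rankOne ℂ x x - rankOne ℂ y y = rankOne ℂ (x - y) x + rankOne ℂ y (x - y) := by
    simp only [map_sub, _root_.sub_apply]
    abel
  rw [h]
  refine (norm_add_le _ _).trans (le_of_eq ?_)
  rw [norm_rankOne, norm_rankOne]
  ring

theorem norm_smul_rankOne_self_sub_le {r : ℝ} (hr : 0 ≤ r) (x y : V) :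
    ‖(r : ℂ) • rankOne ℂ x x - (r : ℂ) • rankOne ℂ y y‖ ≤ r * (‖x - y‖ * (‖x‖ + ‖y‖)) := by
  rw [← smul_sub, norm_smul, Complex.norm_real, Real.norm_of_nonneg hr]
  exact mul_le_mul_of_nonneg_left (norm_rankOne_self_sub_le x y) hr

theorem rankOne_smul_smul (c : ℂ) (x : V) :
    rankOne ℂ (c • x) (c • x) = (c * starRingEnd ℂ c) • rankOne ℂ x x := by
  refine ContinuousLinearMap.ext fun y => ?_
  simp only [rankOne_apply, _root_.smul_apply, inner_smul_left, smul_smul]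
  congr 1
  ring

theorem rankOne_sqrt_smul {w : ℝ} (hw : 0 ≤ w) (x : V) :
    rankOne ℂ (((√w : ℝ) : ℂ) • x) (((√w : ℝ) : ℂ) • x) = (w : ℂ) • rankOne ℂ x x := by
  rw [rankOne_smul_smul, Complex.conj_ofReal, ← Complex.ofReal_mul, Real.mul_self_sqrt hw]

theorem continuous_rankOne_self : Continuous fun x : V => rankOne ℂ x x :=
  ((ContinuousLinearMap.smulRightL ℂ V V).continuous.comp (innerSL ℂ).continuous).clm_apply
    continuous_id

variable [FiniteDimensional ℂ V]

/-- An operator that is a limit of convex combinations of operators `|φ⟩⟨φ|` with `φ` in a compact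
set that is star-shaped about the origin is a sum of such operators. -/
theorem exists_eq_sum_rankOne_of_approx {K : Set V} (hK : IsCompact K)
    (hstar : ∀ x ∈ K, ∀ t : ℝ, 0 ≤ t → t ≤ 1 → (t : ℂ) • x ∈ K) (T : V →L[ℂ] V)
    (hT : ∀ ε > 0, ∃ (M : ℕ) (q : Fin M → ℝ) (φ : Fin M → V), (∀ i, 0 ≤ q i) ∧ ∑ i, q i = 1 ∧
      (∀ i, φ i ∈ K) ∧ ‖T - ∑ i, (q i : ℂ) • rankOne ℂ (φ i) (φ i)‖ ≤ ε) :
    ∃ (m : ℕ) (φ : Fin m → V), (∀ i, φ i ∈ K) ∧ T = ∑ i, rankOne ℂ (φ i) (φ i) := by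
  -- Carathéodory's bound on the number of terms. It reduces the convex hull to a finite union of
  -- the compact sets `H m`, which is closed.
  set N := Module.finrank ℝ (V →L[ℂ] V) + 1
  let H : ℕ → Set (V →L[ℂ] V) := fun m =>
    (fun φ : Fin m → V => ∑ i, rankOne ℂ (φ i) (φ i)) '' Set.univ.pi fun _ => K
  have hclosed : IsClosed (⋃ m ∈ Finset.range (N + 1), H m) := by
    refine isClosed_biUnion_finset fun m _ => IsCompact.isClosed ?_
    refine (isCompact_univ_pi fun _ => hK).image ?_
    exact continuous_finsetSum _ fun i _ => continuous_rankOne_self.comp (continuous_apply i)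
  have hsub : convexHull ℝ ((fun x => rankOne ℂ x x) '' K) ⊆ ⋃ m ∈ Finset.range (N + 1), H m := by
    intro S hS
    obtain ⟨ι, _, z, w, hz, hind, hw, hw1, rfl⟩ := eq_pos_convex_span_of_mem_convexHull hS
    have hcard : Fintype.card ι < N + 1 := Nat.lt_succ_of_le <|
      hind.card_le_finrank_succ.trans (Nat.succ_le_succ (Submodule.finrank_le _))
    choose x hxK hx using fun i => hz ⟨i, rfl⟩
    refine Set.mem_biUnion (Finset.mem_coe.2 (Finset.mem_range.2 hcard)) ?_
    let e := Fintype.equivFin ι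
    have hwle : ∀ i, w i ≤ 1 := fun i => by
      rw [← hw1]
      exact Finset.single_le_sum (fun j _ => (hw j).le) (Finset.mem_univ i)
    -- The weight `w` is absorbed into the vector as a factor `√w ≤ 1`, which star-shapedness
    -- permits.
    refine ⟨fun k => ((√(w (e.symm k)) : ℝ) : ℂ) • x (e.symm k), fun k _ =>
      hstar _ (hxK _) _ (Real.sqrt_nonneg _) (Real.sqrt_le_one.2 (hwle _)), ?_⟩
    simp only [rankOne_sqrt_smul (hw _).le]
    rw [e.symm.sum_comp fun i => (w i : ℂ) • rankOne ℂ (x i) (x i)]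
    refine Finset.sum_congr rfl fun i _ => ?_
    rw [← hx]
    exact Complex.coe_smul _ _
  have hmem : T ∈ closure (convexHull ℝ ((fun x => rankOne ℂ x x) '' K)) := by
    refine Metric.mem_closure_iff.2 fun ε hε => ?_
    obtain ⟨M, q, φ, hq, hq1, hφ, hle⟩ := hT (ε / 2) (by positivity)
    refine ⟨∑ i, (q i : ℂ) • rankOne ℂ (φ i) (φ i), ?_, ?_⟩
    · have := (convex_convexHull ℝ ((fun x => rankOne ℂ x x) '' K)).sum_mem (t := Finset.univ)
        (fun i _ => hq i) hq1 fun i _ => subset_convexHull ℝ _ ⟨φ i, hφ i, rfl⟩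
      convert this using 2
      exact Complex.coe_smul _ _
    · rw [dist_eq_norm]
      linarith
  have := closure_minimal hsub hclosed hmem
  simp only [Set.mem_iUnion] at this
  obtain ⟨m, -, φ, hφ, rfl⟩ := this
  exact ⟨m, φ, fun i => hφ i trivial, rfl⟩

end Compactness

/-! ### From Schmidt vectors to pure-state decompositions and back -/

section Decompositions

open InnerProductSpace

variable {A B : Type*}
  [NormedAddCommGroup A] [InnerProductSpace ℂ A]
  [NormedAddCommGroup B] [InnerProductSpace ℂ B]

/-- The vectors `∑ i ∈ s, x i ⊗ y i` with `x i` and `y i` in the unit balls. -/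
def boundedTensors (A B : Type*) [NormedAddCommGroup A] [InnerProductSpace ℂ A]
    [NormedAddCommGroup B] [InnerProductSpace ℂ B] {ι : Type*} (s : Finset ι) : Set (A ⊗[ℂ] B) :=
  (fun p : (ι → A) × (ι → B) => ∑ i ∈ s, p.1 i ⊗ₜ[ℂ] p.2 i) ''
    ((Set.univ.pi fun _ => Metric.closedBall 0 1) ×ˢ (Set.univ.pi fun _ => Metric.closedBall 0 1))

theorem continuous_tmul : Continuous fun p : A × B => p.1 ⊗ₜ[ℂ] p.2 := by
  let L : A →L[ℂ] B →L[ℂ] A ⊗[ℂ] B := LinearMap.mkContinuous₂ (TensorProduct.mk ℂ A B) 1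
    fun x y => by simp
  exact (L.continuous.comp continuous_fst).clm_apply continuous_snd

theorem sum_tmul_mem_boundedTensors {ι : Type*} {s : Finset ι} {x : ι → A} {y : ι → B}
    (hx : ∀ i, ‖x i‖ ≤ 1) (hy : ∀ i, ‖y i‖ ≤ 1) :
    ∑ i ∈ s, x i ⊗ₜ[ℂ] y i ∈ boundedTensors A B s :=
  ⟨(x, y), ⟨fun i _ => by simpa using hx i, fun i _ => by simpa using hy i⟩, rfl⟩

theorem smul_mem_boundedTensors {ι : Type*} {s : Finset ι} {φ : A ⊗[ℂ] B}
    (h : φ ∈ boundedTensors A B s) {t : ℝ} (ht0 : 0 ≤ t) (ht1 : t ≤ 1) :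
    (t : ℂ) • φ ∈ boundedTensors A B s := by
  obtain ⟨⟨x, y⟩, ⟨hx, hy⟩, rfl⟩ := h
  have hx : ∀ i, ‖x i‖ ≤ 1 := fun i => by simpa using hx i trivial
  have hy : ∀ i, ‖y i‖ ≤ 1 := fun i => by simpa using hy i trivial
  simp only [Finset.smul_sum, TensorProduct.smul_tmul']
  refine sum_tmul_mem_boundedTensors (fun i => ?_) hy
  rw [norm_smul, Complex.norm_real, Real.norm_of_nonneg ht0]
  exact mul_le_one₀ ht1 (norm_nonneg _) (hx i)

/-- Truncating a Schmidt decomposition to its `n` leading terms. -/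
theorem IsSortedSchmidtVector.exists_truncation {ψ : A ⊗[ℂ] B}
    {μ : OrderedSimplex (min (Module.finrank ℂ A) (Module.finrank ℂ B))}
    (h : IsSortedSchmidtVector ψ μ) (n : ℕ) :
    ∃ φ ∈ boundedTensors A B (Finset.univ.filter
        fun i : Fin (min (Module.finrank ℂ A) (Module.finrank ℂ B)) => (i : ℕ) < n),
      ‖φ‖ ≤ 1 ∧ ‖ψ - φ‖ ^ 2 = 1 - μ.partialSum n := by
  obtain ⟨a, b, ha, hb, rfl⟩ := h
  have hab := ha.tmul_self_index hb
  have hnorm : ∀ i, ‖((√(μ.toFun i) : ℝ) : ℂ)‖ ^ 2 = μ.toFun i := fun i => by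
    rw [Complex.norm_real, Real.norm_of_nonneg (Real.sqrt_nonneg _), Real.sq_sqrt (μ.nonneg i)]
  have hle : ∀ i, μ.toFun i ≤ 1 := fun i => by
    rw [← μ.sum_eq_one]
    exact Finset.single_le_sum (fun j _ => μ.nonneg j) (Finset.mem_univ i)
  refine ⟨∑ i ∈ Finset.univ.filter (fun i : Fin _ => (i : ℕ) < n),
    ((√(μ.toFun i) : ℝ) : ℂ) • (a i ⊗ₜ[ℂ] b i), ?_, ?_, ?_⟩
  · simp only [TensorProduct.smul_tmul']
    refine sum_tmul_mem_boundedTensors (fun i => ?_) fun i => (hb.1 i).le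
    rw [norm_smul, ha.1, mul_one, Complex.norm_real, Real.norm_of_nonneg (Real.sqrt_nonneg _)]
    exact Real.sqrt_le_one.2 (hle i)
  · rw [← sq_le_one_iff₀ (norm_nonneg _), hab.norm_sum_smul_sq]
    simp only [hnorm]
    exact μ.partialSum_le_one n
  · rw [← Finset.sum_filter_add_sum_filter_not Finset.univ (fun i : Fin _ => (i : ℕ) < n)
      (fun i => ((√(μ.toFun i) : ℝ) : ℂ) • (a i ⊗ₜ[ℂ] b i)), add_sub_cancel_left,
      hab.norm_sum_smul_sq]
    simp only [hnorm]
    rw [eq_sub_iff_add_eq', OrderedSimplex.partialSum, Finset.sum_filter_add_sum_filter_not,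
      μ.sum_eq_one]

variable [FiniteDimensional ℂ A] [FiniteDimensional ℂ B]

/-- A continuous image of a product of closed balls. Working with this set gives compactness under a
rank bound without any semicontinuity of the Schmidt rank. -/
theorem isCompact_boundedTensors {ι : Type*} (s : Finset ι) :
    IsCompact (boundedTensors A B s) := by
  have := FiniteDimensional.proper ℂ A
  have := FiniteDimensional.proper ℂ B
  refine ((isCompact_univ_pi fun _ => isCompact_closedBall _ _).prod
    (isCompact_univ_pi fun _ => isCompact_closedBall _ _)).image ?_
  refine continuous_finsetSum _ fun i _ => ?_
  have h : Continuous fun p : (ι → A) × (ι → B) => (p.1 i, p.2 i) := by fun_prop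
  exact continuous_tmul.comp h

theorem pureSchmidtRank_le_card {ι : Type*} {s : Finset ι} {φ : A ⊗[ℂ] B}
    (h : φ ∈ boundedTensors A B s) : pureSchmidtRank φ ≤ s.card := by
  obtain ⟨⟨x, y⟩, -, rfl⟩ := h
  exact pureSchmidtRank_sum_tmul_le s x y

/-- Zero vectors are dropped and the others normalized; their squared norms become the weights,
which sum to the trace of `ρ`. -/
theorem exists_isPureDecomposition_of_sum {ρ : A ⊗[ℂ] B →ₗ[ℂ] A ⊗[ℂ] B}
    (htr : LinearMap.trace ℂ (A ⊗[ℂ] B) ρ = 1) {m n : ℕ} {φ : Fin m → A ⊗[ℂ] B}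
    (hφ : ∀ i, pureSchmidtRank (φ i) ≤ n) (h : ρ = ∑ i, ketbra (φ i)) :
    ∃ (M : ℕ) (q : Fin M → ℝ) (ψ : Fin M → A ⊗[ℂ] B), IsPureDecomposition ρ q ψ ∧
      ∀ i, pureSchmidtRank (ψ i) ≤ n := by
  classical
  let e := Fintype.equivFin {i // φ i ≠ 0}
  have hne : ∀ k, ‖φ (e.symm k)‖ ≠ 0 := fun k => norm_ne_zero_iff.2 (e.symm k).2
  have hsum : ρ = ∑ k, ketbra (φ (e.symm k)) := by
    rw [e.symm.sum_comp fun i : {i // φ i ≠ 0} => ketbra (φ i), h,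
      ← Finset.sum_subtype (Finset.univ.filter fun i => φ i ≠ 0) (by simp) fun i => ketbra (φ i)]
    refine (Finset.sum_filter_of_ne (p := fun i => φ i ≠ 0) fun i _ hi h0 => hi ?_).symm
    rw [h0]
    simp [ketbra]
  have hker : ∀ k, ((‖φ (e.symm k)‖ ^ 2 : ℝ) : ℂ) •
      ketbra (((‖φ (e.symm k)‖⁻¹ : ℝ) : ℂ) • φ (e.symm k)) = ketbra (φ (e.symm k)) := fun k => by
    rw [ketbra_smul, smul_smul, Complex.conj_ofReal, ← Complex.ofReal_mul, ← Complex.ofReal_mul]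
    have : ‖φ (e.symm k)‖ ^ 2 * (‖φ (e.symm k)‖⁻¹ * ‖φ (e.symm k)‖⁻¹) = 1 := by
      field_simp [hne k]
    rw [this, Complex.ofReal_one, one_smul]
  refine ⟨_, fun k => ‖φ (e.symm k)‖ ^ 2, fun k => ((‖φ (e.symm k)‖⁻¹ : ℝ) : ℂ) • φ (e.symm k),
    ⟨fun k => by positivity, ?_, fun k => ?_, ?_⟩, fun k =>
      (pureSchmidtRank_smul_le _ _).trans (hφ _)⟩
  · rw [hsum, map_sum] at htr
    have h1 : ∀ ψ : A ⊗[ℂ] B, LinearMap.trace ℂ _ (ketbra ψ) = ((‖ψ‖ ^ 2 : ℝ) : ℂ) := fun ψ => by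
      rw [ketbra, trace_rankOne, inner_self_eq_norm_sq_to_K]
      push_cast
      rfl
    simp only [h1] at htr
    exact_mod_cast htr
  · rw [norm_smul, Complex.norm_real, norm_inv, norm_norm, inv_mul_cancel₀ (hne k)]
  · rw [hsum]
    exact Finset.sum_congr rfl fun k _ => (hker k).symm

theorem IsBipartiteState.exists_eq_sum_ketbra {ρ : A ⊗[ℂ] B →ₗ[ℂ] A ⊗[ℂ] B}
    (hρ : IsBipartiteState ρ) : ∃ (m : ℕ) (φ : Fin m → A ⊗[ℂ] B), ρ = ∑ i, ketbra (φ i) := by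
  have h := (LinearMap.isPositive_toContinuousLinearMap_iff ρ).2 hρ.1
  obtain ⟨m, φ, hφ⟩ := ContinuousLinearMap.isPositive_iff_eq_sum_rankOne.1 h
  refine ⟨m, φ, ?_⟩
  have := congrArg ContinuousLinearMap.toLinearMap hφ
  rw [ContinuousLinearMap.toLinearMap_sum] at this
  exact this

/-- Every pure-state decomposition yields an averaged Schmidt vector, and its partial sums
are one from the largest Schmidt rank on. -/
theorem IsPureDecomposition.exists_mem_averagedSchmidtVectors
    {ρ : A ⊗[ℂ] B →ₗ[ℂ] A ⊗[ℂ] B} {M n : ℕ} {q : Fin M → ℝ} {ψ : Fin M → A ⊗[ℂ] B}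
    (h : IsPureDecomposition ρ q ψ) (hn : ∀ i, pureSchmidtRank (ψ i) ≤ n) :
    ∃ u ∈ averagedSchmidtVectors ρ, u.partialSum n = 1 := by
  choose μ hμ using fun i => exists_isSortedSchmidtVector (h.norm_eq_one i)
  refine ⟨⟨fun j => ∑ i, q i * (μ i).toFun j,
    fun j => Finset.sum_nonneg fun i _ => mul_nonneg (h.nonneg i) ((μ i).nonneg j), ?_,
    fun j k hjk => Finset.sum_le_sum fun i _ =>
      mul_le_mul_of_nonneg_left ((μ i).antitone hjk) (h.nonneg i)⟩,
    ⟨M, q, ψ, μ, h, hμ, fun _ => rfl⟩, ?_⟩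
  · rw [Finset.sum_comm]
    simp only [← Finset.mul_sum, (μ _).sum_eq_one, mul_one, h.sum_eq_one]
  · have h1 : ∀ i, (μ i).partialSum n = 1 := fun i => by
      refine le_antisymm ((μ i).partialSum_le_one n) ?_
      rw [← (μ i).partialSum_supportCard]
      exact (μ i).partialSum_mono ((hμ i).supportCard_eq.trans_le (hn i))
    simp only [OrderedSimplex.partialSum] at h1 ⊢
    rw [Finset.sum_comm]
    simp only [← Finset.mul_sum, h1, mul_one, h.sum_eq_one]

/-- Each Schmidt decomposition is cut to `n` terms. The discarded squared norms average to `1 -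
u.partialSum n < δ ^ 2`, which controls the operator error. -/
theorem exists_approx_of_lt_partialSum {ρ : A ⊗[ℂ] B →ₗ[ℂ] A ⊗[ℂ] B} {n : ℕ} {δ : ℝ} (hδ : 0 < δ)
    {u : OrderedSimplex (min (Module.finrank ℂ A) (Module.finrank ℂ B))}
    (hu : u ∈ averagedSchmidtVectors ρ) (hun : 1 - δ ^ 2 < u.partialSum n) :
    ∃ (M : ℕ) (q : Fin M → ℝ) (φ : Fin M → A ⊗[ℂ] B), (∀ i, 0 ≤ q i) ∧ ∑ i, q i = 1 ∧
      (∀ i, φ i ∈ boundedTensors A B (Finset.univ.filter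
        fun i : Fin (min (Module.finrank ℂ A) (Module.finrank ℂ B)) => (i : ℕ) < n)) ∧
      ‖ρ.toContinuousLinearMap - ∑ i, (q i : ℂ) • rankOne ℂ (φ i) (φ i)‖ ≤ 2 * δ := by
  obtain ⟨M, q, ψ, μ, h, hμ, huμ⟩ := hu
  choose φ hφ hφ1 hψφ using fun i => (hμ i).exists_truncation n
  refine ⟨M, q, φ, h.nonneg, h.sum_eq_one, hφ, ?_⟩
  have hρ : ρ.toContinuousLinearMap = ∑ i, (q i : ℂ) • rankOne ℂ (ψ i) (ψ i) := by
    rw [h.eq_sum, map_sum]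
    rfl
  have hsum : ∑ i, q i * (1 - (μ i).partialSum n) ≤ δ ^ 2 := by
    have h1 : u.partialSum n = ∑ i, q i * (μ i).partialSum n := by
      simp only [OrderedSimplex.partialSum, huμ, Finset.mul_sum]
      exact Finset.sum_comm
    simp only [mul_sub, mul_one, Finset.sum_sub_distrib, h.sum_eq_one, ← h1]
    linarith
  rw [hρ, ← Finset.sum_sub_distrib]
  -- With `x = ‖ψ i - φ i‖`, the error is at most `2 * x ≤ x ^ 2 / δ + δ`; this makes it linear in
  -- `x ^ 2`, ready for averaging.
  have hterm : ∀ i, ‖(q i : ℂ) • rankOne ℂ (ψ i) (ψ i) - (q i : ℂ) • rankOne ℂ (φ i) (φ i)‖ ≤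
      q i * (1 - (μ i).partialSum n) / δ + q i * δ := fun i => by
    rw [← hψφ, mul_div_assoc, ← mul_add]
    refine (norm_smul_rankOne_self_sub_le (h.nonneg i) _ _).trans
      (mul_le_mul_of_nonneg_left ?_ (h.nonneg i))
    rw [h.norm_eq_one]
    have h0 := norm_nonneg (ψ i - φ i)
    have h1 : ‖ψ i - φ i‖ * (1 + ‖φ i‖) ≤ ‖ψ i - φ i‖ * 2 :=
      mul_le_mul_of_nonneg_left (by linarith [hφ1 i]) h0
    have h2 : ‖ψ i - φ i‖ ^ 2 / δ + δ - ‖ψ i - φ i‖ * 2 = (‖ψ i - φ i‖ - δ) ^ 2 / δ := by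
      field_simp
      ring
    have h3 : 0 ≤ (‖ψ i - φ i‖ - δ) ^ 2 / δ := by positivity
    linarith
  refine (norm_sum_le _ _).trans ((Finset.sum_le_sum fun i _ => hterm i).trans ?_)
  rw [Finset.sum_add_distrib, ← Finset.sum_div, ← Finset.sum_mul, h.sum_eq_one]
  have : (∑ i, q i * (1 - (μ i).partialSum n)) / δ ≤ δ := by
    rw [div_le_iff₀ hδ]
    linarith
  linarith

/-- If the `n`-th partial sum of the Schmidt vector is one, then some pure-state decomposition
consists of vectors of Schmidt rank at most `n`. -/
theorem IsSchmidtVector.exists_isPureDecomposition {ρ : A ⊗[ℂ] B →ₗ[ℂ] A ⊗[ℂ] B}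
    (htr : LinearMap.trace ℂ (A ⊗[ℂ] B) ρ = 1)
    {ν : OrderedSimplex (min (Module.finrank ℂ A) (Module.finrank ℂ B))} (hν : IsSchmidtVector ρ ν)
    (hne : (averagedSchmidtVectors ρ).Nonempty) {n : ℕ} (hn : ν.partialSum n = 1) :
    ∃ (M : ℕ) (q : Fin M → ℝ) (ψ : Fin M → A ⊗[ℂ] B), IsPureDecomposition ρ q ψ ∧
      ∀ i, pureSchmidtRank (ψ i) ≤ n := by
  obtain ⟨m, φ, hφ, hsum⟩ := exists_eq_sum_rankOne_of_approx
    (isCompact_boundedTensors (A := A) (B := B) (Finset.univ.filter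
      fun i : Fin (min (Module.finrank ℂ A) (Module.finrank ℂ B)) => (i : ℕ) < n))
    (fun _ hx _ => smul_mem_boundedTensors hx) ρ.toContinuousLinearMap fun ε hε => by
      obtain ⟨u, hu, hun⟩ := OrderedSimplex.exists_lt_partialSum hne hν hn
        (show 0 < (ε / 2) ^ 2 by positivity)
      have := exists_approx_of_lt_partialSum (half_pos hε) hu hun
      rwa [mul_div_cancel₀ _ two_ne_zero] at this
  refine exists_isPureDecomposition_of_sum htr (fun i => (pureSchmidtRank_le_card (hφ i)).trans ?_)
    ((congrArg ContinuousLinearMap.toLinearMap hsum).trans ?_)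
  · rw [Fin.card_filter_val_lt]
    exact min_le_right _ _
  · rw [ContinuousLinearMap.toLinearMap_sum]
    rfl

/-- The averaged vector of the given decomposition already has `n`-th partial sum 1, and `ν`
majorizes it. -/
theorem IsSchmidtVector.supportCard_le {ρ : A ⊗[ℂ] B →ₗ[ℂ] A ⊗[ℂ] B}
    {ν : OrderedSimplex (min (Module.finrank ℂ A) (Module.finrank ℂ B))} (hν : IsSchmidtVector ρ ν)
    {M n : ℕ} {q : Fin M → ℝ} {ψ : Fin M → A ⊗[ℂ] B} (h : IsPureDecomposition ρ q ψ)
    (hn : ∀ i, pureSchmidtRank (ψ i) ≤ n) : ν.supportCard ≤ n := by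
  obtain ⟨u, hu, hun⟩ := h.exists_mem_averagedSchmidtVectors hn
  exact ν.supportCard_le_of_partialSum_eq_one (le_antisymm (ν.partialSum_le_one n)
    (hun.symm.trans_le (OrderedSimplex.partialSum_le_of_le (hν.1 hu) n)))

end Decompositions

end

/-! ### Equality of Schmidt rank and Schmidt number -/

theorem mainTheorem1 {A B : Type*}
    [NormedAddCommGroup A] [InnerProductSpace ℂ A] [FiniteDimensional ℂ A]
    [NormedAddCommGroup B] [InnerProductSpace ℂ B] [FiniteDimensional ℂ B]
    (ρ : A ⊗[ℂ] B →ₗ[ℂ] A ⊗[ℂ] B) (hρ : IsBipartiteState ρ) :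
    ∃ ν : OrderedSimplex (min (Module.finrank ℂ A) (Module.finrank ℂ B)),
      IsSchmidtVector ρ ν ∧
        HasSchmidtNumber ρ ν.supportCard ∧
        IsLeast (maxSchmidtRanks ρ) ν.supportCard := by
  have hne : (averagedSchmidtVectors ρ).Nonempty := by
    obtain ⟨m, φ, hφ⟩ := hρ.exists_eq_sum_ketbra
    -- Any rank bound would do here; the maximum of the ranks is one.
    obtain ⟨M, q, ψ, h, hn⟩ := exists_isPureDecomposition_of_sum hρ.2
      (fun i => Finset.le_sup (f := fun i => pureSchmidtRank (φ i)) (Finset.mem_univ i)) hφ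
    obtain ⟨u, hu, -⟩ := h.exists_mem_averagedSchmidtVectors hn
    exact ⟨u, hu⟩
  obtain ⟨ν, hν⟩ := OrderedSimplex.exists_isLUB hne
  have hν : IsSchmidtVector ρ ν := hν
  obtain ⟨M, q, ψ, h, hn⟩ := hν.exists_isPureDecomposition hρ.2 hne ν.partialSum_supportCard
  refine ⟨ν, hν, ⟨fun M' q' ψ' h' => ?_, M, q, ψ, h, hn⟩, ⟨M, q, ψ, h, ?_⟩, ?_⟩
  · by_contra! hlt
    have h1 := hν.supportCard_le h' fun i => Nat.le_sub_one_of_lt (hlt i)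
    have h2 := ν.supportCard_pos
    omega
  · exact le_antisymm (hν.supportCard_le h fun i =>
      Finset.le_sup (f := fun i => pureSchmidtRank (ψ i)) (Finset.mem_univ i))
      (Finset.sup_le fun i _ => hn i)
  · rintro _ ⟨M', q', ψ', h', rfl⟩
    exact hν.supportCard_le h' fun i =>
      Finset.le_sup (f := fun i => pureSchmidtRank (ψ' i)) (Finset.mem_univ i)
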